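/- Theorem. Notation: $[n]=\{1,\dots,n\}$, and $\widetilde O(\cdot)$ hides a constant factor and a factor polylogarithmic in $n$, both depending only on the fixed constants $\alpha,\varepsilon$ (and on the family of graphs and the bounds in the hypothesis below), but not on $n,k,S$. A deterministic branching program for inputs $(x_i)_{i\in I}$ with $x_i\in D_i$ is a layered directed acyclic graph with an initial vertex in its first layer; each vertex not in the last layer is labelled with a coordinate $i\in I$ and has, for each value in $D_i$, one edge to the next layer. It has space $s$ and time $t$ if it has at most $t+1$ layers, each with at most $2^s$ vertices; it is oblivious if all vertices in the same layer carry the same label. For a single-output function, the output is a label of the last vertex of the computation path. For a multi-output function $F$ with values in $R^J$, each edge may carry arbitrarily many statements $(j,r)\in J\times R$, and on every input $x$ the statements along the computation path must be exactly the pairs $(j,F(x)_j)$, $j\in J$. The problem 2-StepPointerChasing has input $f:[n]\to[n]$ (as the tuple of its values) and output $(x,f(f(x)))$ for all $x\in[n]$. Fix constants $\alpha>0$ and $0<\varepsilon<1$. For $n$ and $k\le n$, the Guruswami–Umans–Vadhan (GUV) graph $\Gamma_{\alpha,n,k}\subseteq[n]\times[m]$ is defined as follows. Let $d=\max(1,\lceil\log_2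 n\rceil)$, $\kappa=\max(1,\lceil\log_2 k\rceil)$, $h=\lceil(2d\kappa/\varepsilon)^{1/\alpha}\rceil$, let $q$ be the power of two in $(h^{1+\alpha}/2,h^{1+\alpha}]$, let $\mu=\lceil\log k/\log h\rceil$ and $m=q^{\mu+1}$, and let $E\in\mathbb F_q[Y]$ be a monic irreducible polynomial of degree $d$. Identify $[n]$ with a set of $n$ polynomials in $\mathbb F_q[Y]$ of degree less than $d$, and $[m]$ with $\mathbb F_q^{\mu+1}$. The edges at the polynomial $p$ lead to the vertices $$\bigl(y,\;p(y),\;(p^{h}\bmod E)(y),\;\dots,\;(p^{h^{\mu-1}}\bmod E)(y)\bigr),\qquad y\in\mathbb F_q .$$ Fix, for all $n$ and $k$, any choice of $E$ and of these identifications. The problem $(\alpha,n,k)$-ExpanderMatching is the function $[n]^k\times[m]\to[n]\cup\{\perp\}$ that, on input $(L,y)$, regards $L$ as a subset of $[n]$ of size at most $k$, takes the lexicographically smallest matching $\mathcal M:L\to[m]$ of $L$ in $\Gamma_{\alpha,n,k}$, and outputs $\mathcal M^{-1}(y)$ if it exists and $\perp$ otherwise. Suppose that for all $1\le k\le n$,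 $(\alpha,n,k)$-ExpanderMatching can be solved by a deterministic oblivious branching program with space $\widetilde O(1)$ and time $\widetilde O(k)$. Then for all integers $1\le S\le n$ there is a deterministic oblivious branching program solving 2-StepPointerChasing with space $\widetilde O(S)$ and time $\widetilde O\bigl(\sqrt{n^{3+\alpha}/S}\bigr)$. -/

import Mathlib

/-! ### Branching programs -/

/-- A deterministic branching program reading an input `x : ∀ i, D i` (coordinate `i` ranges over the
domain `D i`). It is a layered DAG with layers `0, …, length`. Each vertex `v` of a layer other than
the last one is labelled by the coordinate `label t v` that is queried there, and it has one edge to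
the next layer for every possible value of that coordinate. Output labels are not part of the
structure, see `ComputesLast` and `ComputesMulti`. -/
structure BranchingProgram {ι : Type} (D : ι → Type) where
  length : ℕ
  vertex : Fin (length + 1) → Type
  finite : ∀ t, Finite (vertex t)
  start : vertex 0
  label : ∀ t : Fin length, vertex t.castSucc → ι
  next : ∀ (t : Fin length) (v : vertex t.castSucc), D (label t v) → vertex t.succ

namespace BranchingProgram

variable {ι : Type} {D : ι → Type}

/-- The vertex in layer `t` of the computation path on input `x`. -/
def state (P : BranchingProgram D) (x : ∀ i, D i) (t : Fin (P.length + 1)) : P.vertex t :=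
  Fin.induction P.start (fun t v => P.next t v (x (P.label t v))) t

/-- All vertices in the same layer query the same coordinate. -/
def IsOblivious (P : BranchingProgram D) : Prop :=
  ∀ (t : Fin P.length) (v w : P.vertex t.castSucc), P.label t v = P.label t w

/-- Space at most `s`: every layer has at most `2 ^ s` vertices. -/
def HasSpace (P : BranchingProgram D) (s : ℝ) : Prop :=
  ∀ t, (Nat.card (P.vertex t) : ℝ) ≤ (2 : ℝ) ^ s

/-- Time at most `τ`: there are at most `τ + 1` layers. -/
def HasTime (P : BranchingProgram D) (τ : ℝ) : Prop :=
  (P.length : ℝ) ≤ τ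

/-- Single-output functions: the vertices of the last layer can be labelled with values such that on
every input `x` the label at the end of the computation path is `F x`. -/
def ComputesLast {R : Type} (P : BranchingProgram D) (F : (∀ i, D i) → R) : Prop :=
  ∃ lab : P.vertex (Fin.last P.length) → R, ∀ x, lab (P.state x (Fin.last P.length)) = F x

/-- Multi-output functions: every edge can be labelled with a set of output statements `(j, r)` such
that on every input `x` the collection of the statements on the computation path is complete and
consistent and determines `F x`, i.e. consists exactly of the pairs `(j, F x j)`. -/
def ComputesMulti {J R : Type} (P : BranchingProgram D) (F : (∀ i, D i) → J → R) : Prop :=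
  ∃ out : ∀ (t : Fin P.length) (v : P.vertex t.castSucc), D (P.label t v) → Set (J × R),
    ∀ (x : ∀ i, D i) (j : J) (r : R),
      (∃ t : Fin P.length,
        (j, r) ∈ out t (P.state x t.castSucc) (x (P.label t (P.state x t.castSucc)))) ↔ r = F x j

end BranchingProgram

/-! ### The two-step pointer chasing problem -/

/-- The input is `f : [n] → [n]`, the output consists of `(x, f (f x))` for all `x ∈ [n]`. -/
def twoStepPointerChasing (n : ℕ) (f : Fin n → Fin n) (x : Fin n) : Fin n :=
  f (f x)

/-! ### The explicit unbalanced expanders of Guruswami, Umans and Vadhan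

Parameters for `n` left vertices and sets of size at most `k`, with constants `α > 0` and
`0 < ε < 1`. The graph is an expander with expansion factor `(1 - ε) q`, where `q` is the left
degree. -/

namespace GUV

/-- The number `⌈log₂ n⌉` of coefficients of the message polynomials (at least one). -/
def deg (n : ℕ) : ℕ := max 1 (Nat.clog 2 n)

/-- The base `h = ⌈(2 ⌈log₂ n⌉ ⌈log₂ k⌉ / ε) ^ (1 / α)⌉` (logarithms replaced by `1` if they vanish). -/
noncomputable def base (α ε : ℝ) (n k : ℕ) : ℕ :=
  ⌈(2 * (deg n : ℝ) * (max 1 (Nat.clog 2 k) : ℕ) / ε) ^ (1 / α)⌉₊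

/-- The exponent `s` such that `q = 2 ^ s` is the power of two in `(h ^ (1 + α) / 2, h ^ (1 + α)]`. -/
noncomputable def fieldExp (α ε : ℝ) (n k : ℕ) : ℕ :=
  Nat.log 2 ⌊(base α ε n k : ℝ) ^ (1 + α)⌋₊

/-- The field `𝔽_q`, `q = 2 ^ s`. -/
abbrev 𝔽 (α ε : ℝ) (n k : ℕ) : Type := GaloisField 2 (fieldExp α ε n k)

/-- The number `⌈log k / log h⌉` of evaluated powers of the message polynomial. -/
noncomputable def numPow (α ε : ℝ) (n k : ℕ) : ℕ := Nat.clog (base α ε n k) k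

/-- The number `m = q ^ (⌈log k / log h⌉ + 1)` of right vertices. -/
noncomputable def rightSize (α ε : ℝ) (n k : ℕ) : ℕ :=
  (2 ^ fieldExp α ε n k) ^ (numPow α ε n k + 1)

/-- The choices that the construction leaves open: a monic irreducible polynomial `E` over `𝔽_q` of
degree `deg n`, the identification of the left vertices `[n]` with polynomials of degree less than
`deg n`, and an enumeration of the right vertices. -/
structure Choice (α ε : ℝ) (n k : ℕ) where
  E : Polynomial (𝔽 α ε n k)
  monic : E.Monic
  irreducible : Irreducible E
  natDegree_eq : E.natDegree = deg n
  left : Fin n ↪ Polynomial.degreeLT (𝔽 α ε n k) (deg n)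
  right : 𝔽 α ε n k × (Fin (numPow α ε n k) → 𝔽 α ε n k) ≃ Fin (rightSize α ε n k)

/-- The bipartite graph on `[n] × [m]`: a polynomial `f` and a seed `y ∈ 𝔽_q` give the edge from `f` to
`(y, f(y), (f ^ h mod E)(y), (f ^ (h ^ 2) mod E)(y), …)`. -/
def Choice.graph {α ε : ℝ} {n k : ℕ} (G : Choice α ε n k) :
    Set (Fin n × Fin (rightSize α ε n k)) :=
  {e | ∃ y : 𝔽 α ε n k, e.2 = G.right (y, fun i =>
    ((G.left e.1 : Polynomial (𝔽 α ε n k)) ^ (base α ε n k ^ (i : ℕ)) % G.E).eval y)}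

theorem two_le_base {α ε : ℝ} (hα : 0 < α) (hε₀ : 0 < ε) (hε₁ : ε < 1) (n k : ℕ) :
    2 ≤ base α ε n k := by
  unfold base
  have h : (1:ℝ) < 2 * (deg n : ℝ) * (max 1 (Nat.clog 2 k) : ℕ) / ε := by
    rw [lt_div_iff₀ hε₀]
    have h1 : (1:ℝ) ≤ deg n := by unfold deg; exact_mod_cast le_max_left _ _
    have h2 : (1:ℝ) ≤ ((max 1 (Nat.clog 2 k) : ℕ) : ℝ) := by exact_mod_cast le_max_left _ _
    nlinarith
  have := Real.one_lt_rpow h (z := 1/α) (by positivity)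
  exact Nat.lt_ceil.2 (by exact_mod_cast this)

theorem fieldExp_ne_zero {α ε : ℝ} (hα : 0 < α) (hε₀ : 0 < ε) (hε₁ : ε < 1) (n k : ℕ) :
    fieldExp α ε n k ≠ 0 := by
  unfold fieldExp
  have h2 : (2:ℝ) ≤ base α ε n k := by exact_mod_cast two_le_base hα hε₀ hε₁ n k
  have : (base α ε n k : ℝ)^(1:ℝ) ≤ (base α ε n k : ℝ)^(1+α) :=
    Real.rpow_le_rpow_of_exponent_le (by linarith) (by linarith)
  rw [Real.rpow_one] at this
  have h3 : 2 ≤ ⌊(base α ε n k : ℝ) ^ (1 + α)⌋₊ := Nat.le_floor (by push_cast; linarith)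
  exact (Nat.log_pos (by norm_num) h3).ne'

/-- The construction can always be carried out. -/
theorem choice_nonempty {α ε : ℝ} (hα : 0 < α) (hε₀ : 0 < ε) (hε₁ : ε < 1) (n k : ℕ) :
    Nonempty (Choice α ε n k) := by
  have hs := fieldExp_ne_zero hα hε₀ hε₁ n k
  have hc := GaloisField.card 2 _ hs
  have hd : deg n ≠ 0 := by unfold deg; simp
  have : NeZero (deg n) := ⟨hd⟩
  have hfin : Finite (𝔽 α ε n k) := Nat.finite_of_card_ne_zero (by rw [hc]; positivity)
  obtain ⟨a, ha⟩ := Field.exists_primitive_element (𝔽 α ε n k) (FiniteField.Extension (𝔽 α ε n k) 2 (deg n))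
  have hi : IsIntegral (𝔽 α ε n k) a := IsIntegral.of_finite _ _
  have : Fintype (𝔽 α ε n k) := Fintype.ofFinite _
  have hm : (minpoly (𝔽 α ε n k) a).natDegree = deg n := by
    rw [← IntermediateField.adjoin.finrank hi, ha, IntermediateField.finrank_top',
      FiniteField.finrank_extension]
  have e := (Polynomial.degreeLTEquiv (𝔽 α ε n k) (deg n)).toEquiv
  have hcd : Fintype.card (𝔽 α ε n k) = 2 ^ fieldExp α ε n k := by rw [← hc, Nat.card_eq_fintype_card]
  have l : Nonempty (Fin n ↪ (Fin (deg n) → 𝔽 α ε n k)) := by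
    apply Function.Embedding.nonempty_of_card_le
    rw [Fintype.card_fun, hcd, Fintype.card_fin, Fintype.card_fin]
    calc n ≤ 2 ^ Nat.clog 2 n := Nat.le_pow_clog (by norm_num) n
      _ ≤ 2 ^ deg n := Nat.pow_le_pow_right (by norm_num) (le_max_right _ _)
      _ ≤ _ := Nat.pow_le_pow_left (Nat.le_self_pow hs 2) _
  refine ⟨⟨minpoly _ a, minpoly.monic hi, minpoly.irreducible hi, hm, l.some.trans e.symm.toEmbedding,
    Fintype.equivFinOfCardEq ?_⟩⟩
  rw [Fintype.card_prod, Fintype.card_fun, hcd, Fintype.card_fin, rightSize, pow_succ, mul_comm]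

end GUV

/-! ### The expander matching problem -/

/-- `M` is a matching for the set `L` of left vertices in the bipartite graph `Γ`. -/
def IsMatchingFor {n m : ℕ} (Γ : Set (Fin n × Fin m)) (L : Finset (Fin n)) (M : L → Fin m) : Prop :=
  Function.Injective M ∧ ∀ x : L, ((x : Fin n), M x) ∈ Γ

/-- `M` is the lexicographically smallest matching for `L` in `Γ`. -/
def IsLexLeastMatching {n m : ℕ} (Γ : Set (Fin n × Fin m)) (L : Finset (Fin n))
    (M : L → Fin m) : Prop :=
  IsLeast {M' : Lex (L → Fin m) | IsMatchingFor Γ L (ofLex M')} (toLex M)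

/-- The partner of `y` in the lexicographically smallest matching for `L`, or `none` if there is none. -/
noncomputable def lexMatchingInv {n m : ℕ} (Γ : Set (Fin n × Fin m)) (L : Finset (Fin n))
    (y : Fin m) : Option (Fin n) :=
  open Classical in
  if h : ∃ x : L, ∃ M : L → Fin m, IsLexLeastMatching Γ L M ∧ M x = y then some h.choose else none

/-- An input of the problem consists of `k` coordinates `some j` in `[n]` and one coordinate `none`
in `[m]`. -/
def MatchingInput (n k m : ℕ) : Option (Fin k) → Type
  | none => Fin m
  | some _ => Fin n

/-- The matching problem `[n] ^ k × [m] → [n] ∪ {⊥}` for a bipartite graph `Γ`; the first `k`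
coordinates are regarded as a set of left vertices. -/
noncomputable def expanderMatching {n m : ℕ} (k : ℕ) (Γ : Set (Fin n × Fin m))
    (x : ∀ i, MatchingInput n k m i) : Option (Fin n) :=
  lexMatchingInv Γ (Finset.univ.image fun j : Fin k => (x (some j) : Fin n)) (x none)

/-!
Two-step pointer chasing is solved by lookups through the matching graph. Split the `n`
arguments into chunks of `k`. For a chunk `X`, the values `L = f(X)` form a set of at most `k` left
vertices of the graph `Γ`, and a program for the matching problem has access to `L` through the input
`f` itself. For every right vertex `y` it finds the partner `z = M⁻¹(y) ∈ L`, if there is one. Since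
`z` is adjacent to `y`, an oblivious program can fetch `f z` by reading `f` at all neighbours of `y`,
and then it reads `f` on `X` once more in order to announce `f (f x) = f z` for those `x ∈ X` with
`f x = z`. Treating `S` right vertices in parallel takes `S` times the space of the matching program,
and for each chunk a total time of about `(m / S) k + |Γ|`, where `m` is roughly `k ^ (1 + α)` and
`|Γ|`, the number of edges, is roughly `n`. Over all `n / k` chunks this is `n k ^ (1 + α) / S + n ^ 2 / k` up to
polylogarithmic factors, and `k ≈ √(S n ^ (1 - α))` gives the claim (`exists_chunk_size`,
`time_estimate`).

All values `f x` are found because every set `L` of at most `k` left vertices has a matching in `Γ`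
(`GUV.Choice.exists_isMatchingFor`). By Hall's theorem this follows from the case of expansion factor
one of the theorem of Guruswami, Umans and Vadhan, which is proved by their polynomial method in
`GUV.card_le_card_of_eval_mem`. The program is assembled in `PointerChasing.exists_program` from
blocks, one for each chunk and each group of `S` right vertices, whose output does not depend on the
vertex in which they are entered (`PointerChasing.outputs_block`).
-/

/-! ### Hall's condition for the Guruswami–Umans–Vadhan graph -/

namespace GUV

open Polynomial in
/-- The expansion argument of Guruswami, Umans and Vadhan in the form needed for Hall's condition: a
set of at most `h ^ μ` polynomials has at least as many neighbours as elements. If `T` were smaller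
than `A`, a nonzero polynomial `Q` in `μ` variables with individual degrees below `h` and at most
`#A` monomials would vanish on `T`. For `f ∈ A`, the univariate polynomial
`Q (f, f ^ h mod E, …)` has fewer than `#F` roots unless it is zero, so that the residue class of `f`
is a root of a fixed nonzero polynomial of degree below `#A` over the field `F[Y] / (E)`. -/
theorem card_le_card_of_eval_mem {F : Type*} [Field F] [Fintype F]
    {E : F[X]} (hE : Irreducible E) {d h μ : ℕ} (hd : E.natDegree = d)
    (A : Finset F[X]) (hA : ∀ f ∈ A, f.degree < d) (hcard : A.card ≤ h ^ μ)
    (hq : (d - 1) * (h - 1) * μ < Fintype.card F) (T : Finset (F × (Fin μ → F)))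
    (hT : ∀ f ∈ A, ∀ y : F, (y, fun i : Fin μ => (f ^ h ^ (i : ℕ) % E).eval y) ∈ T) :
    A.card ≤ T.card := by
  classical
  by_contra! hlt
  have hE0 : E ≠ 0 := hE.ne_zero
  -- the digits of `b` in base `h` are the exponents of the `b`-th monomial
  let dig : Fin A.card → Fin μ → ℕ := fun b i =>
    (finFunctionFinEquiv.symm (Fin.castLE hcard b) i : ℕ)
  have hdig : ∀ b i, dig b i ≤ h - 1 := fun b i =>
    Nat.le_sub_one_of_lt (finFunctionFinEquiv.symm (Fin.castLE hcard b) i).isLt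
  have hsum : ∀ b, ∑ i : Fin μ, h ^ (i : ℕ) * dig b i = b := by
    intro b
    have := finFunctionFinEquiv_apply (finFunctionFinEquiv.symm (Fin.castLE hcard b))
    rw [Equiv.apply_symm_apply] at this
    simpa [dig, mul_comm] using this.symm
  let Φ : (Fin A.card → F) →ₗ[F] (T → F) :=
    Matrix.toLin' (Matrix.of fun (t : T) b => ∏ i, (t.1.2 i) ^ dig b i)
  have hker : LinearMap.ker Φ ≠ ⊥ := Φ.ker_ne_bot_of_finrank_lt (by simpa using hlt)
  obtain ⟨c, hc, hc0⟩ := (Submodule.ne_bot_iff _).mp hker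
  have hvan : ∀ t ∈ T, ∑ b, (∏ i, (t.2 i) ^ dig b i) * c b = 0 := by
    intro t ht
    have := congrFun (LinearMap.mem_ker.mp hc) ⟨t, ht⟩
    simpa [Φ, Matrix.toLin'_apply, Matrix.mulVec, dotProduct] using this
  let R : F[X] → F[X] := fun f => ∑ b, (∏ i : Fin μ, (f ^ h ^ (i : ℕ) % E) ^ dig b i) * C (c b)
  have hmod : ∀ g : F[X], (g % E).natDegree ≤ d - 1 := by
    intro g
    have hu : 0 < E.natDegree := hE.natDegree_pos
    have := natDegree_mod_lt g hu.ne'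
    omega
  have hR : ∀ f ∈ A, R f = 0 := by
    intro f hf
    refine eq_zero_of_natDegree_lt_card_of_eval_eq_zero (R f) Function.injective_id
      (fun y => ?_) (lt_of_le_of_lt ?_ hq)
    · have := hvan _ (hT f hf y)
      simpa [R, eval_finsetSum, eval_prod] using this
    · refine natDegree_sum_le_of_forall_le _ _ fun b _ => ?_
      refine (natDegree_mul_C_le _ _).trans ((natDegree_prod_le _ _).trans ?_)
      calc ∑ i : Fin μ, ((f ^ h ^ (i : ℕ) % E) ^ dig b i).natDegree
          ≤ ∑ _i : Fin μ, (d - 1) * (h - 1) := Finset.sum_le_sum fun i _ =>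
            (natDegree_pow_le.trans (Nat.mul_le_mul (hdig b i) (hmod _))).trans
              (Nat.mul_comm _ _).le
        _ = (d - 1) * (h - 1) * μ := by simp [mul_comm]
  have : Fact (Irreducible E) := ⟨hE⟩
  have hmk : ∀ g : F[X], AdjoinRoot.mk E (g % E) = AdjoinRoot.mk E g := by
    intro g
    rw [AdjoinRoot.mk_eq_mk]
    exact ⟨-(g / E), by linear_combination EuclideanDomain.mod_add_div g E⟩
  -- modulo `E`, the `b`-th monomial becomes `f ^ b`, because the exponents are the digits of `b`
  let Q : (AdjoinRoot E)[X] := ∑ b : Fin A.card, C (AdjoinRoot.of E (c b)) * X ^ (b : ℕ)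
  have hQ0 : Q = 0 := by
    refine eq_zero_of_natDegree_lt_card_of_eval_eq_zero (ι := A) Q
      (f := fun f => AdjoinRoot.mk E f.1) ?_ ?_ ?_
    · rintro ⟨f, hf⟩ ⟨g, hg⟩ hfg
      rw [AdjoinRoot.mk_eq_mk] at hfg
      have hlt' : (f - g).degree < E.degree := by
        rw [degree_eq_natDegree hE0, hd]
        exact (degree_sub_le f g).trans_lt (max_lt (hA f hf) (hA g hg))
      exact Subtype.ext (sub_eq_zero.mp (eq_zero_of_dvd_of_degree_lt hfg hlt'))
    · rintro ⟨f, hf⟩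
      have := congrArg (AdjoinRoot.mk E) (hR f hf)
      simp only [R, map_sum, map_mul, map_prod, map_pow, hmk, map_zero, ← pow_mul,
        Finset.prod_pow_eq_pow_sum, hsum, AdjoinRoot.mk_C] at this
      simp only [Q, eval_finsetSum, eval_mul, eval_C, eval_pow, eval_X]
      rw [← this]
      exact Finset.sum_congr rfl fun b _ => mul_comm _ _
    · rw [Fintype.card_coe]
      have hpos : 0 < A.card := by omega
      refine lt_of_le_of_lt (natDegree_sum_le_of_forall_le (n := A.card - 1) _ _ fun b _ => ?_)
        (Nat.sub_lt hpos one_pos)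
      exact (natDegree_C_mul_X_pow_le _ _).trans (by omega)
  apply hc0
  funext b
  have := congrArg (fun p => p.coeff (b : ℕ)) hQ0
  simp only [Q, finsetSum_coeff, coeff_C_mul, coeff_X_pow, coeff_zero, Fin.val_inj, mul_ite,
    mul_one, mul_zero, Finset.sum_ite_eq, Finset.mem_univ, if_true] at this
  simpa using this

variable {α ε : ℝ}

theorem one_le_deg (n : ℕ) : 1 ≤ deg n := le_max_left _ _

/-- The field is large enough for the degrees that occur in the expansion argument. -/
theorem deg_mul_base_mul_lt (hα : 0 < α) (hε₀ : 0 < ε) (hε₁ : ε < 1) (n k : ℕ) :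
    (deg n - 1) * (base α ε n k - 1) * numPow α ε n k < 2 ^ fieldExp α ε n k := by
  have hb := two_le_base hα hε₀ hε₁ n k
  set h := base α ε n k with hh
  set κ : ℕ := max 1 (Nat.clog 2 k) with hκ
  have hμ : numPow α ε n k ≤ κ :=
    (Nat.clog_anti_left (by norm_num) hb).trans (le_max_right _ _)
  have hκ1 : 1 ≤ κ := le_max_left _ _
  have hd := one_le_deg n
  have h0 : (0 : ℝ) < h := by exact_mod_cast (by omega : 0 < h)
  have key : (2 * deg n * κ : ℝ) ≤ (h : ℝ) ^ α := by
    have hu : (0 : ℝ) ≤ 2 * (deg n : ℝ) * κ / ε := by positivity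
    have h1 : (2 * (deg n : ℝ) * κ / ε) ^ (1 / α) ≤ h := Nat.le_ceil _
    have h2 := Real.rpow_le_rpow (by positivity) h1 hα.le
    rw [← Real.rpow_mul hu, one_div_mul_cancel hα.ne', Real.rpow_one] at h2
    refine le_trans ?_ h2
    rw [le_div_iff₀ hε₀]
    exact mul_le_of_le_one_right (by positivity) hε₁.le
  have hlt : (h : ℝ) ^ (1 + α) < 2 * 2 ^ fieldExp α ε n k := by
    have := Nat.lt_pow_succ_log_self (b := 2) (by norm_num) ⌊(h : ℝ) ^ (1 + α)⌋₊
    have h3 := Nat.lt_of_floor_lt this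
    rw [pow_succ, mul_comm] at h3
    exact_mod_cast h3
  have hmain : (deg n * h * κ : ℝ) < 2 ^ fieldExp α ε n k := by
    rw [Real.rpow_add h0, Real.rpow_one] at hlt
    nlinarith
  have hmain' : deg n * h * κ < 2 ^ fieldExp α ε n k := by exact_mod_cast hmain
  refine lt_of_le_of_lt ?_ hmain'
  gcongr <;> omega

theorem card_field (hα : 0 < α) (hε₀ : 0 < ε) (hε₁ : ε < 1) (n k : ℕ) :
    Nat.card (𝔽 α ε n k) = 2 ^ fieldExp α ε n k :=
  GaloisField.card 2 _ (fieldExp_ne_zero hα hε₀ hε₁ n k)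

theorem finite_field (hα : 0 < α) (hε₀ : 0 < ε) (hε₁ : ε < 1) (n k : ℕ) :
    Finite (𝔽 α ε n k) :=
  Nat.finite_of_card_ne_zero (by rw [card_field hα hε₀ hε₁]; positivity)

/-- Hall's condition for sets of at most `k` left vertices. -/
theorem Choice.exists_isMatchingFor (hα : 0 < α) (hε₀ : 0 < ε) (hε₁ : ε < 1) {n k : ℕ}
    (G : Choice α ε n k) (L : Finset (Fin n)) (hL : L.card ≤ k) :
    ∃ M : L → Fin (rightSize α ε n k), IsMatchingFor G.graph L M := by
  classical
  have := finite_field hα hε₀ hε₁ n k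
  have : Fintype (𝔽 α ε n k) := Fintype.ofFinite _
  let nb : L → Finset (Fin (rightSize α ε n k)) := fun x =>
    Finset.univ.filter fun y => ((x : Fin n), y) ∈ G.graph
  have hall : ∀ B : Finset L, B.card ≤ (B.biUnion nb).card := by
    intro B
    let poly : L ↪ Polynomial (𝔽 α ε n k) :=
      (Function.Embedding.subtype _).trans (G.left.trans (Function.Embedding.subtype _))
    have := card_le_card_of_eval_mem G.irreducible G.natDegree_eq (h := base α ε n k)
      (μ := numPow α ε n k) (B.map poly) ?_ ?_ ?_ ((B.biUnion nb).map G.right.symm.toEmbedding) ?_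
    · simpa using this
    · intro f hf
      obtain ⟨x, -, rfl⟩ := Finset.mem_map.mp hf
      exact Polynomial.mem_degreeLT.mp (G.left x).2
    · rw [Finset.card_map]
      have hB : B.card ≤ L.card := by simpa using B.card_le_univ
      exact (hB.trans hL).trans (Nat.le_pow_clog (two_le_base hα hε₀ hε₁ n k) k)
    · rw [← Nat.card_eq_fintype_card, card_field hα hε₀ hε₁]
      exact deg_mul_base_mul_lt hα hε₀ hε₁ n k
    · intro f hf y
      obtain ⟨x, hx, rfl⟩ := Finset.mem_map.mp hf
      rw [Finset.mem_map_equiv, Equiv.symm_symm, Finset.mem_biUnion]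
      exact ⟨x, hx, Finset.mem_filter.mpr ⟨Finset.mem_univ _, y, rfl⟩⟩
  obtain ⟨M, hinj, hM⟩ := (Finset.all_card_le_biUnion_card_iff_exists_injective nb).mp hall
  exact ⟨M, hinj, fun x => (Finset.mem_filter.mp (hM x)).2⟩

/-- Every left vertex has at most `q` neighbours. -/
theorem Choice.ncard_graph_le (hα : 0 < α) (hε₀ : 0 < ε) (hε₁ : ε < 1) {n k : ℕ}
    (G : Choice α ε n k) : G.graph.ncard ≤ n * 2 ^ fieldExp α ε n k := by
  have := finite_field hα hε₀ hε₁ n k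
  let e : Fin n × 𝔽 α ε n k → Fin n × Fin (rightSize α ε n k) := fun p =>
    (p.1, G.right (p.2, fun i =>
      ((G.left p.1 : Polynomial (𝔽 α ε n k)) ^ (base α ε n k ^ (i : ℕ)) % G.E).eval p.2))
  have hsub : G.graph ⊆ e '' Set.univ := by
    rintro ⟨x, z⟩ ⟨y, hy⟩
    exact ⟨(x, y), trivial, Prod.ext rfl hy.symm⟩
  calc G.graph.ncard ≤ (e '' Set.univ).ncard := Set.ncard_le_ncard hsub (Set.toFinite _)
    _ ≤ (Set.univ : Set (Fin n × 𝔽 α ε n k)).ncard := Set.ncard_image_le (Set.toFinite _)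
    _ = n * 2 ^ fieldExp α ε n k := by
      rw [Set.ncard_univ, Nat.card_prod, Nat.card_fin, card_field hα hε₀ hε₁]

end GUV

/-! ### The lexicographically smallest matching -/

theorem exists_isLexLeastMatching {n m : ℕ} {Γ : Set (Fin n × Fin m)} {L : Finset (Fin n)}
    (h : ∃ M : L → Fin m, IsMatchingFor Γ L M) : ∃ M : L → Fin m, IsLexLeastMatching Γ L M := by
  obtain ⟨M₀, hM₀⟩ := h
  have : Finite (Lex (L → Fin m)) := inferInstanceAs (Finite (L → Fin m))
  obtain ⟨M, hM⟩ := Set.exists_min_image {M' : Lex (L → Fin m) | IsMatchingFor Γ L (ofLex M')} id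
    (Set.toFinite _) ⟨toLex M₀, hM₀⟩
  exact ⟨ofLex M, hM.1, fun M' hM' => hM.2 M' hM'⟩

theorem mem_of_lexMatchingInv_eq_some {n m : ℕ} {Γ : Set (Fin n × Fin m)} {L : Finset (Fin n)}
    {y : Fin m} {z : Fin n} (h : lexMatchingInv Γ L y = some z) : (z, y) ∈ Γ := by
  unfold lexMatchingInv at h
  split_ifs at h with hx
  obtain ⟨M, hM, hy⟩ := hx.choose_spec
  have := hM.1.2 hx.choose
  rwa [ofLex_toLex, hy, Option.some.inj h] at this

theorem exists_lexMatchingInv_eq_some {n m : ℕ} {Γ : Set (Fin n × Fin m)} {L : Finset (Fin n)}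
    (h : ∃ M : L → Fin m, IsMatchingFor Γ L M) {z : Fin n} (hz : z ∈ L) :
    ∃ y, lexMatchingInv Γ L y = some z := by
  obtain ⟨M, hM⟩ := exists_isLexLeastMatching h
  have hx : ∃ x : L, ∃ M' : L → Fin m, IsLexLeastMatching Γ L M' ∧ M' x = M ⟨z, hz⟩ :=
    ⟨⟨z, hz⟩, M, hM, rfl⟩
  refine ⟨M ⟨z, hz⟩, ?_⟩
  unfold lexMatchingInv
  rw [dif_pos hx, Option.some_inj]
  obtain ⟨M', hM', hy⟩ := hx.choose_spec
  obtain rfl : M' = M := toLex.injective (hM'.unique hM)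
  exact congrArg Subtype.val (hM.1.1 hy)

/-! ### Straight-line descriptions of oblivious programs -/

/-- One layer of an oblivious program with a fixed set `σ` of vertices in every layer, for inputs
`ι → A` and output statements in `O`: the coordinate that is read, the transition, and the statements
that are made along the edges. -/
structure ObliviousStep (ι A σ O : Type) where
  query : ι
  next : σ → A → σ
  out : σ → A → Set O

namespace ObliviousStep

variable {ι A σ O : Type}

/-- The vertex that is reached from `s` on input `f`. -/
def run (f : ι → A) (s : σ) : List (ObliviousStep ι A σ O) → σ
  | [] => s
  | a :: l => run f (a.next s (f a.query)) l

/-- The statements that are made along the path starting from `s` on input `f`. -/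
def outputs (f : ι → A) (s : σ) : List (ObliviousStep ι A σ O) → Set O
  | [] => ∅
  | a :: l => a.out s (f a.query) ∪ outputs f (a.next s (f a.query)) l

theorem run_append (f : ι → A) (s : σ) (l l' : List (ObliviousStep ι A σ O)) :
    run f s (l ++ l') = run f (run f s l) l' := by
  induction l generalizing s with
  | nil => rfl
  | cons a l ih => exact ih _

theorem outputs_append (f : ι → A) (s : σ) (l l' : List (ObliviousStep ι A σ O)) :
    outputs f s (l ++ l') = outputs f s l ∪ outputs f (run f s l) l' := by
  induction l generalizing s with
  | nil => simp [outputs, run]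
  | cons a l ih => simp only [List.cons_append, outputs, run, ih, Set.union_assoc]

theorem run_take_succ (f : ι → A) (s : σ) (l : List (ObliviousStep ι A σ O)) (t : ℕ)
    (ht : t < l.length) :
    run f s (l.take (t + 1)) = l[t].next (run f s (l.take t)) (f l[t].query) := by
  rw [List.take_succ_eq_append_getElem ht, run_append]
  rfl

theorem mem_outputs_iff (f : ι → A) (s : σ) (l : List (ObliviousStep ι A σ O)) (o : O) :
    o ∈ outputs f s l ↔
      ∃ t : Fin l.length, o ∈ l[t].out (run f s (l.take t)) (f l[t].query) := by
  induction l generalizing s with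
  | nil => simp [outputs]
  | cons a l ih =>
    rw [outputs, Set.mem_union, ih]
    exact (Fin.exists_fin_succ (n := l.length) (P := fun t => o ∈ (a :: l)[t].out
      (run f s ((a :: l).take t)) (f (a :: l)[t].query))).symm

theorem outputs_eq_empty (f : ι → A) (s : σ) (l : List (ObliviousStep ι A σ O))
    (h : ∀ a ∈ l, ∀ s x, a.out s x = ∅) : outputs f s l = ∅ := by
  induction l generalizing s with
  | nil => rfl
  | cons a l ih =>
    rw [outputs, h a (by simp), ih _ fun b hb => h b (by simp [hb]), Set.union_empty]

theorem outputs_flatMap {β : Type*} (f : ι → A) (B : β → List (ObliviousStep ι A σ O))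
    (W : β → Set O) (l : List β) (h : ∀ b ∈ l, ∀ s, outputs f s (B b) = W b) (s : σ) :
    outputs f s (l.flatMap B) = {o | ∃ b ∈ l, o ∈ W b} := by
  induction l generalizing s with
  | nil => simp [outputs]
  | cons a l ih =>
    rw [List.flatMap_cons, outputs_append, h a (by simp), ih fun b hb => h b (by simp [hb])]
    ext o
    simp

/-- The branching program with the layers described by `l`. -/
def toProgram (l : List (ObliviousStep ι A σ O)) [Finite σ] (s : σ) :
    BranchingProgram (fun _ : ι => A) where
  length := l.length
  vertex _ := σ
  finite _ := inferInstance
  start := s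
  label t _ := l[t].query
  next t v a := l[t].next v a

theorem state_toProgram (l : List (ObliviousStep ι A σ O)) [Finite σ] (s : σ) (f : ι → A)
    (t : Fin (l.length + 1)) : (toProgram l s).state f t = run f s (l.take t) := by
  induction t using Fin.induction with
  | zero => rfl
  | succ t ih =>
    have h : (toProgram l s).state f t.succ =
      l[t].next ((toProgram l s).state f t.castSucc) (f l[t].query) := rfl
    rw [h, ih]
    exact (run_take_succ f s l t t.2).symm

theorem computesMulti_toProgram {J R : Type} (l : List (ObliviousStep ι A σ (J × R))) [Finite σ]
    (s : σ) (F : (ι → A) → J → R) (h : ∀ f j r, (j, r) ∈ outputs f s l ↔ r = F f j) :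
    (toProgram l s).ComputesMulti F := by
  refine ⟨fun t v a => l[t].out v a, fun f j r => ?_⟩
  rw [← h, mem_outputs_iff]
  exact exists_congr fun t : Fin l.length => iff_of_eq
    (congrArg (fun v => (j, r) ∈ l[t].out v (f l[t].query)) (state_toProgram l s f t.castSucc))

end ObliviousStep

/-! ### Processing one chunk of arguments and one group of right vertices -/

namespace PointerChasing

open ObliviousStep BranchingProgram

/-- The input of the matching problem with the left vertices `g` and the right vertex `y`. -/
def inputOf {n k m : ℕ} (g : Fin k → Fin n) (y : Fin m) : ∀ i, MatchingInput n k m i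
  | none => y
  | some j => g j

/-- A program for the matching problem whose vertices are numbered by `Fin N` in every layer. -/
structure Matcher (n k m N : ℕ) where
  prog : BranchingProgram (MatchingInput n k m)
  oblivious : prog.IsOblivious
  enc : ∀ t, prog.vertex t → Fin N
  dec : ∀ t, Fin N → prog.vertex t
  dec_enc : ∀ t v, dec t (enc t v) = v
  answer : prog.vertex (Fin.last prog.length) → Option (Fin n)

variable {n k m N : ℕ} (Q : Matcher n k m N)

namespace Matcher

/-- The answer at the number of a vertex of the last layer. -/
def res (v : Fin N) : Option (Fin n) := Q.answer (Q.dec _ v)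

/-- The coordinate that is read in layer `t`; as the program is oblivious, the vertex that is used
for the definition does not matter. -/
def label (t : Fin Q.prog.length) : Option (Fin k) :=
  Q.prog.label t (Q.dec _ (Q.enc 0 Q.prog.start))

end Matcher

/-- For each of the `S` right vertices of a group: the current vertex of the matching program, and a
register for one value of `f`. -/
abbrev State (n N S : ℕ) : Type := Fin S → Fin N × Fin n

/-- The steps that are used for pointer chasing. -/
abbrev Step (n N S : ℕ) : Type := ObliviousStep (Fin n) (Fin n) (State n N S) (Fin n × Fin n)

variable {S : ℕ} (x₀ : Fin n) (idx : Fin k → Fin n) (ys : Fin S → Fin m) (zs : List (Fin n))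

/-- Return to the start vertex of the matching program; the value that is read is ignored. -/
def resetStep : Step n N S where
  query := x₀
  next _ _ := fun _ => (Q.enc 0 Q.prog.start, x₀)
  out _ _ := ∅

/-- Layer `t` of the matching program, for all right vertices `ys i` at once. The left vertices are
the values of `f` at `idx`; nothing needs to be read if the program asks for the right vertex. -/
def simStep (t : Fin Q.prog.length) : Step n N S where
  query := ((Q.label t).map idx).getD x₀
  next s a := fun i =>
    let v := Q.dec t.castSucc (s i).1
    (Q.enc t.succ (Q.prog.next t v (inputOf (fun _ => a) (ys i) (Q.prog.label t v))), (s i).2)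
  out _ _ := ∅

/-- Read `f z`, and store it in all registers for which `z` is the partner. -/
def fetchStep (z : Fin n) : Step n N S where
  query := z
  next s a := fun i => if Q.res (s i).1 = some z then ((s i).1, a) else s i
  out _ _ := ∅

/-- Read `f (idx j)`, and announce the registers for which this value is the partner. -/
def emitStep (j : Fin k) : Step n N S where
  query := idx j
  next s _ := s
  out s a := {p | p.1 = idx j ∧ ∃ i, Q.res (s i).1 = some a ∧ p.2 = (s i).2}

/-- Find the partners `z` of the right vertices `ys` in the matching for the values of `f` on the
chunk `idx`, read `f z` by going through the candidates `zs`, and announce `f (f x) = f z` for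
all `x` in the chunk with `f x = z`. -/
def block : List (Step n N S) :=
  resetStep Q x₀ :: ((List.finRange Q.prog.length).map (simStep Q x₀ idx ys) ++
    (zs.map (fetchStep Q) ++ (List.finRange k).map (emitStep Q idx)))

theorem length_block :
    (block Q x₀ idx ys zs).length = Q.prog.length + zs.length + k + 1 := by
  simp [block, add_assoc]

theorem simStep_next (f : Fin n → Fin n) (t : Fin Q.prog.length) (w : Fin S → Fin n) :
    (simStep Q x₀ idx ys t).next
        (fun i => (Q.enc t.castSucc (Q.prog.state (inputOf (f ∘ idx) (ys i)) t.castSucc), w i))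
        (f (simStep Q x₀ idx ys t).query) =
      fun i => (Q.enc t.succ (Q.prog.state (inputOf (f ∘ idx) (ys i)) t.succ), w i) := by
  funext i
  have hl : Q.label t = Q.prog.label t (Q.prog.state (inputOf (f ∘ idx) (ys i)) t.castSucc) :=
    Q.oblivious _ _ _
  have key : ∀ v, v = Q.prog.state (inputOf (f ∘ idx) (ys i)) t.castSucc →
      Q.prog.next t v (inputOf (fun _ => f (((Q.label t).map idx).getD x₀)) (ys i)
        (Q.prog.label t v)) = Q.prog.state (inputOf (f ∘ idx) (ys i)) t.succ := by
    rintro v rfl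
    change _ = Q.prog.next t (Q.prog.state (inputOf (f ∘ idx) (ys i)) t.castSucc)
      (inputOf (f ∘ idx) (ys i) (Q.prog.label t _))
    congr 1
    rw [← hl]
    cases Q.label t <;> rfl
  exact Prod.ext (congrArg (Q.enc t.succ) (key _ (Q.dec_enc _ _))) rfl

theorem run_simStep (f : Fin n → Fin n) (w : Fin S → Fin n) :
    run f (fun i => (Q.enc 0 Q.prog.start, w i))
        ((List.finRange Q.prog.length).map (simStep Q x₀ idx ys)) =
      fun i => (Q.enc _ (Q.prog.state (inputOf (f ∘ idx) (ys i)) (Fin.last _)), w i) := by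
  have key : ∀ t : Fin (Q.prog.length + 1), run f (fun i => (Q.enc 0 Q.prog.start, w i))
        (((List.finRange Q.prog.length).map (simStep Q x₀ idx ys)).take t) =
      fun i => (Q.enc _ (Q.prog.state (inputOf (f ∘ idx) (ys i)) t), w i) := by
    intro t
    induction t using Fin.induction with
    | zero => rfl
    | succ t ih =>
      rw [← simStep_next Q x₀, ← ih, Fin.val_succ, run_take_succ _ _ _ _ (by simp)]
      simp
  have := key (Fin.last _)
  rwa [List.take_of_length_le (by simp)] at this

theorem run_fetchStep_fst (f : Fin n → Fin n) (s : State n N S) (i : Fin S) :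
    (run f s (zs.map (fetchStep Q)) i).1 = (s i).1 := by
  induction zs generalizing s with
  | nil => rfl
  | cons z zs ih =>
    rw [List.map_cons, run, ih]
    simp only [fetchStep]
    split_ifs <;> rfl

theorem run_fetchStep_snd (f : Fin n → Fin n) (s : State n N S) (i : Fin S) (z : Fin n)
    (hz : Q.res (s i).1 = some z) (h : z ∈ zs ∨ (s i).2 = f z) :
    (run f s (zs.map (fetchStep Q)) i).2 = f z := by
  induction zs generalizing s with
  | nil => exact h.resolve_left List.not_mem_nil
  | cons z' zs ih =>
    rw [List.map_cons, run]
    by_cases hzz : z' = z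
    · subst hzz
      apply ih <;> simp [fetchStep, hz]
    · have hne : ¬ Q.res (s i).1 = some z' := by rw [hz]; simpa using Ne.symm hzz
      apply ih
      · simpa [fetchStep, hne] using hz
      · simpa [fetchStep, hne, Ne.symm hzz] using h

theorem outputs_emitStep (f : Fin n → Fin n) (s : State n N S) (js : List (Fin k)) :
    outputs f s (js.map (emitStep Q idx)) = {p | ∃ j ∈ js, p.1 = idx j ∧
      ∃ i, Q.res (s i).1 = some (f (idx j)) ∧ p.2 = (s i).2} := by
  induction js with
  | nil => simp [outputs]
  | cons j js ih =>
    rw [List.map_cons, outputs]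
    change _ ∪ outputs f s _ = _
    rw [ih]
    ext p
    simp [emitStep]

/-- The output of a block does not depend on the vertex in which it is entered. -/
theorem outputs_block {Γ : Set (Fin n × Fin m)}
    (hQ : ∀ x, Q.answer (Q.prog.state x (Fin.last _)) = expanderMatching k Γ x)
    (hzs : ∀ i z, (z, ys i) ∈ Γ → z ∈ zs) (f : Fin n → Fin n) (s : State n N S) :
    outputs f s (block Q x₀ idx ys zs) = {p | ∃ j, p = (idx j, f (f (idx j))) ∧
      ∃ i, lexMatchingInv Γ (Finset.univ.image (f ∘ idx)) (ys i) = some (f (idx j))} := by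
  rw [block, outputs, outputs_append, outputs_append,
    outputs_eq_empty _ _ ((List.finRange _).map _) (by simp [simStep]),
    outputs_eq_empty _ _ (zs.map _) (by simp [fetchStep]), outputs_emitStep]
  simp only [resetStep, Set.empty_union]
  rw [run_simStep Q x₀ idx ys f fun _ => x₀]
  set s' : State n N S := fun i =>
    (Q.enc _ (Q.prog.state (inputOf (f ∘ idx) (ys i)) (Fin.last _)), x₀) with hs'
  have hres : ∀ i, Q.res (s' i).1 =
      lexMatchingInv Γ (Finset.univ.image (f ∘ idx)) (ys i) := by
    intro i
    rw [Matcher.res, hs', Q.dec_enc, hQ]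
    rfl
  ext ⟨p, r⟩
  simp only [run_fetchStep_fst, hres, List.mem_finRange, true_and, Set.mem_ofPred_eq,
    Prod.mk.injEq]
  refine exists_congr fun j => ?_
  rw [and_assoc]
  refine and_congr_right fun _ => ?_
  have hsnd : ∀ i, lexMatchingInv Γ (Finset.univ.image (f ∘ idx)) (ys i) = some (f (idx j)) →
      (run f s' (zs.map (fetchStep Q)) i).2 = f (f (idx j)) := fun i hi =>
    run_fetchStep_snd Q zs f s' i _ ((hres i).trans hi)
      (Or.inl (hzs i _ (mem_of_lexMatchingInv_eq_some hi)))
  constructor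
  · rintro ⟨i, hi, rfl⟩
    exact ⟨hsnd i hi, i, hi⟩
  · rintro ⟨rfl, i, hi⟩
    exact ⟨i, hi, (hsnd i hi).symm⟩

/-! ### The whole program -/

/-- The `c`-th chunk of `k` consecutive elements of `Fin n`; the last chunk is padded with the last
element. It is used both for the chunks of arguments and for the groups of right vertices. -/
def chunk (hn : 0 < n) (k c : ℕ) (j : Fin k) : Fin n :=
  ⟨min (c * k + j) (n - 1), by omega⟩

theorem exists_chunk_eq (hn : 0 < n) (hk : 0 < k) (x : Fin n) :
    ∃ c < (n - 1) / k + 1, ∃ j : Fin k, chunk hn k c j = x := by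
  refine ⟨x / k, Nat.lt_succ_of_le (Nat.div_le_div_right (by omega)),
    ⟨x % k, Nat.mod_lt _ hk⟩, Fin.ext ?_⟩
  have := Nat.div_add_mod' (x : ℕ) k
  simp only [chunk]
  omega

theorem chunk_val_div (hn : 0 < n) (hk : 0 < k) {c : ℕ} (hc : c < (n - 1) / k + 1) (j : Fin k) :
    (chunk hn k c j : ℕ) / k = c := by
  have h : c * k ≤ n - 1 := (Nat.le_div_iff_mul_le hk).mp (by omega)
  rw [Nat.div_eq_iff hk]
  simp only [chunk]
  omega

open Classical in
/-- The left vertices with a neighbour in the `g`-th group of `S` consecutive right vertices. -/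
noncomputable def candidates (Γ : Set (Fin n × Fin m)) (S g : ℕ) : Finset (Fin n) :=
  (Finset.univ.filter fun e : Fin n × Fin m => e ∈ Γ ∧ (e.2 : ℕ) / S = g).image Prod.fst

theorem sum_card_candidates_le (Γ : Set (Fin n × Fin m)) (S g : ℕ) :
    ∑ i ∈ Finset.range g, (candidates Γ S i).card ≤ Γ.ncard := by
  classical
  calc ∑ i ∈ Finset.range g, (candidates Γ S i).card
      ≤ ∑ i ∈ Finset.range g,
        (Γ.toFinset.filter fun e => (e.2 : ℕ) / S = i).card := by
        refine Finset.sum_le_sum fun i _ => Finset.card_image_le.trans (le_of_eq ?_)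
        congr 1
        ext e
        simp
    _ ≤ Γ.toFinset.card := by
        rw [Finset.sum_card_fiberwise_eq_card_filter]
        exact Finset.card_filter_le _ _
    _ = Γ.ncard := (Set.ncard_eq_toFinset_card' Γ).symm

/-- All blocks, for the chunks of arguments and the groups of right vertices. -/
noncomputable def steps (Γ : Set (Fin n × Fin m)) (hn : 0 < n) (hm : 0 < m) (S : ℕ) :
    List (Step n N S) :=
  (List.range ((n - 1) / k + 1)).flatMap fun c => (List.range ((m - 1) / S + 1)).flatMap fun g =>
    block Q ⟨0, hn⟩ (chunk hn k c) (chunk hm S g) (candidates Γ S g).toList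

theorem length_steps_le (Γ : Set (Fin n × Fin m)) (hn : 0 < n) (hm : 0 < m) (S : ℕ) :
    (steps Q Γ hn hm S).length ≤ ((n - 1) / k + 1) *
      (((m - 1) / S + 1) * (Q.prog.length + k + 1) + Γ.ncard) := by
  have h := sum_card_candidates_le Γ S ((m - 1) / S + 1)
  simp only [steps, List.length_flatMap, length_block, Finset.length_toList,
    List.map_const', List.sum_replicate, List.length_range, smul_eq_mul]
  refine Nat.mul_le_mul_left _ ?_
  change ∑ g ∈ Finset.range ((m - 1) / S + 1),
    (Q.prog.length + (candidates Γ S g).card + k + 1) ≤ _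
  simp only [Finset.sum_add_distrib, Finset.sum_const, Finset.card_range, smul_eq_mul]
  linarith

theorem mem_outputs_steps {Γ : Set (Fin n × Fin m)} (hn : 0 < n) (hm : 0 < m) (hk : 0 < k)
    (hS : 0 < S)
    (hQ : ∀ x, Q.answer (Q.prog.state x (Fin.last _)) = expanderMatching k Γ x)
    (hΓ : ∀ L : Finset (Fin n), L.card ≤ k → ∃ M : L → Fin m, IsMatchingFor Γ L M)
    (f : Fin n → Fin n) (s : State n N S) (x r : Fin n) :
    (x, r) ∈ outputs f s (steps Q Γ hn hm S) ↔ r = twoStepPointerChasing n f x := by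
  classical
  have hblock : ∀ c, ∀ g ∈ List.range ((m - 1) / S + 1), ∀ s, outputs f s
      (block Q ⟨0, hn⟩ (chunk hn k c) (chunk hm S g) (candidates Γ S g).toList) = _ :=
    fun c g hg s => outputs_block Q _ _ _ _ hQ (fun i z hz => by
      rw [Finset.mem_toList, candidates, Finset.mem_image]
      exact ⟨(z, chunk hm S g i), by simp [hz, chunk_val_div hm hS (List.mem_range.mp hg) i], rfl⟩)
      f s
  rw [steps, outputs_flatMap f _ _ _ fun c _ s => outputs_flatMap f _ _ _ (hblock c) s]
  simp only [Set.mem_ofPred_eq, Prod.mk.injEq, List.mem_range]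
  constructor
  · rintro ⟨c, -, g, -, j, ⟨rfl, rfl⟩, -⟩
    rfl
  · rintro rfl
    obtain ⟨c, hc, j, rfl⟩ := exists_chunk_eq hn hk x
    obtain ⟨y, hy⟩ := exists_lexMatchingInv_eq_some
      (hΓ (Finset.univ.image (f ∘ chunk hn k c))
        (Finset.card_image_le.trans (by simp)))
      (Finset.mem_image_of_mem _ (Finset.mem_univ j))
    obtain ⟨g, hg, i, rfl⟩ := exists_chunk_eq hm hS y
    exact ⟨c, hc, g, hg, j, ⟨rfl, rfl⟩, i, hy⟩

/-- Pointer chasing from a program for the matching problem in a graph that satisfies Hall's condition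
for sets of at most `k` left vertices, with `S` right vertices treated in parallel. -/
theorem exists_program {Γ : Set (Fin n × Fin m)} (hn : 0 < n) (hm : 0 < m) (hk : 0 < k)
    (hS : 0 < S) (hΓ : ∀ L : Finset (Fin n), L.card ≤ k → ∃ M : L → Fin m, IsMatchingFor Γ L M)
    (P : BranchingProgram (MatchingInput n k m)) (hobl : P.IsOblivious)
    (hN : ∀ t, Nat.card (P.vertex t) ≤ N) (hP : P.ComputesLast (expanderMatching k Γ)) :
    ∃ P' : BranchingProgram (fun _ : Fin n => Fin n), P'.IsOblivious ∧
      (∀ t, Nat.card (P'.vertex t) = (N * n) ^ S) ∧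
      P'.length ≤ ((n - 1) / k + 1) * (((m - 1) / S + 1) * (P.length + k + 1) + Γ.ncard) ∧
      P'.ComputesMulti (twoStepPointerChasing n) := by
  obtain ⟨ans, hans⟩ := hP
  have henc : ∀ t, ∃ (e : P.vertex t → Fin N) (d : Fin N → P.vertex t), ∀ v, d (e v) = v := by
    intro t
    have := P.finite t
    have : Nonempty (P.vertex t) := ⟨P.state (inputOf (fun _ => ⟨0, hn⟩) ⟨0, hm⟩) t⟩
    have e : P.vertex t ↪ Fin N :=
      (Finite.equivFin _).toEmbedding.trans (Fin.castLEEmb (hN t))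
    exact ⟨e, Function.invFun e, Function.leftInverse_invFun e.injective⟩
  choose e d hed using henc
  let Q : Matcher n k m N := ⟨P, hobl, e, d, hed, ans⟩
  refine ⟨toProgram (steps Q Γ hn hm S) fun _ => (e 0 P.start, ⟨0, hn⟩), fun _ _ _ => rfl,
    fun _ => ?_, length_steps_le Q Γ hn hm S,
    computesMulti_toProgram _ _ _ fun f x r => mem_outputs_steps Q hn hm hk hS hans hΓ f _ x r⟩
  change Nat.card (Fin S → Fin N × Fin n) = _
  simp

end PointerChasing

/-! ### Estimates for the parameters -/

theorem one_le_log_add_two {n : ℕ} (hn : 1 ≤ n) : 1 ≤ Real.log (n + 2) := by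
  have h : (1 : ℝ) ≤ n := by exact_mod_cast hn
  rw [Real.le_log_iff_exp_le (by positivity)]
  linarith [Real.exp_one_lt_three]

theorem max_one_clog_le {n k : ℕ} (hn : 1 ≤ n) (hk : k ≤ n) :
    ((max 1 (Nat.clog 2 k) : ℕ) : ℝ) ≤ 3 * Real.log (n + 2) := by
  have hL := one_le_log_add_two hn
  rcases le_or_gt k 1 with h1 | h1
  · rw [Nat.clog_of_right_le_one h1]
    norm_num
    linarith
  · have hpos : 0 < Nat.clog 2 k := Nat.clog_pos (by norm_num) h1
    rw [max_eq_right hpos]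
    have h2 : (2 : ℝ) ^ (Nat.clog 2 k - 1) ≤ n + 2 := by
      have := (Nat.pow_pred_clog_lt_self (b := 2) (by norm_num) h1).le.trans hk
      have h3 : ((2 ^ (Nat.clog 2 k).pred : ℕ) : ℝ) ≤ n := by exact_mod_cast this
      push_cast at h3
      rw [← Nat.pred_eq_sub_one]
      linarith
    have h3 := Real.log_le_log (by positivity) h2
    rw [Real.log_pow, Nat.cast_sub hpos] at h3
    push_cast at h3
    have h4 : (0 : ℝ) ≤ (Nat.clog 2 k : ℝ) - 1 := by
      have : (1 : ℝ) ≤ Nat.clog 2 k := by exact_mod_cast hpos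
      linarith
    nlinarith [Real.log_two_gt_d9]

namespace GUV

variable {α ε : ℝ}

/-- The number `h ^ (1 + α)`, which bounds the field size `q`, is polylogarithmic in `n`. -/
theorem exists_base_rpow_le (hα : 0 < α) (hε₀ : 0 < ε) (hε₁ : ε < 1) :
    ∃ (A : ℝ) (p : ℕ), 1 ≤ A ∧ ∀ n k : ℕ, 1 ≤ n → k ≤ n →
      (base α ε n k : ℝ) ^ (1 + α) ≤ A * Real.log (n + 2) ^ p := by
  set A₀ : ℝ := (2 * (18 / ε) ^ (1 / α)) ^ (1 + α) with hA₀
  have hA₀' : 0 ≤ A₀ := by positivity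
  refine ⟨max 1 A₀, ⌈2 / α * (1 + α)⌉₊, le_max_left _ _, fun n k hn hk => ?_⟩
  set L := Real.log (n + 2) with hLdef
  have hL : 1 ≤ L := one_le_log_add_two hn
  have hL0 : 0 < L := by linarith
  have hd : (deg n : ℝ) ≤ 3 * L := max_one_clog_le hn le_rfl
  have hκ : ((max 1 (Nat.clog 2 k) : ℕ) : ℝ) ≤ 3 * L := max_one_clog_le hn hk
  have hd1 : (1 : ℝ) ≤ deg n := by exact_mod_cast one_le_deg n
  have hκ1 : (1 : ℝ) ≤ ((max 1 (Nat.clog 2 k) : ℕ) : ℝ) := by exact_mod_cast le_max_left _ _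
  have hu1 : 1 ≤ 2 * (deg n : ℝ) * (max 1 (Nat.clog 2 k) : ℕ) / ε := by
    rw [le_div_iff₀ hε₀]
    nlinarith
  have hu : 2 * (deg n : ℝ) * (max 1 (Nat.clog 2 k) : ℕ) / ε ≤ 18 / ε * L ^ 2 := by
    rw [div_mul_eq_mul_div]
    refine div_le_div_of_nonneg_right ?_ hε₀.le
    nlinarith [mul_le_mul hd hκ (by linarith) (by linarith)]
  have hb : (base α ε n k : ℝ) ≤ 2 * (18 / ε * L ^ 2) ^ (1 / α) := by
    have h1 := Real.one_le_rpow hu1 (z := 1 / α) (by positivity)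
    have h2 := Real.rpow_le_rpow (by positivity) hu (z := 1 / α) (by positivity)
    have h3 := (Nat.ceil_lt_add_one (zero_le_one.trans h1)).le
    unfold base
    linarith
  have hLp : (L ^ 2) ^ (1 / α) = L ^ (2 / α) := by
    rw [← Real.rpow_natCast, ← Real.rpow_mul hL0.le]
    congr 1
    push_cast
    ring
  rw [Real.mul_rpow (by positivity) (by positivity), hLp, ← mul_assoc] at hb
  calc (base α ε n k : ℝ) ^ (1 + α)
      ≤ (2 * (18 / ε) ^ (1 / α) * L ^ (2 / α)) ^ (1 + α) :=
        Real.rpow_le_rpow (by positivity) hb (by positivity)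
    _ = A₀ * L ^ (2 / α * (1 + α)) := by
        rw [Real.mul_rpow (by positivity) (by positivity), ← Real.rpow_mul hL0.le]
    _ ≤ A₀ * L ^ ⌈2 / α * (1 + α)⌉₊ := by
        rw [← Real.rpow_natCast]
        exact mul_le_mul_of_nonneg_left
          (Real.rpow_le_rpow_of_exponent_le hL (Nat.le_ceil _)) hA₀'
    _ ≤ max 1 A₀ * L ^ ⌈2 / α * (1 + α)⌉₊ := by
        gcongr
        exact le_max_right _ _

theorem two_pow_fieldExp_le (hα : 0 < α) (hε₀ : 0 < ε) (hε₁ : ε < 1) (n k : ℕ) :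
    (2 : ℝ) ^ fieldExp α ε n k ≤ (base α ε n k : ℝ) ^ (1 + α) := by
  have h1 : (1 : ℝ) ≤ base α ε n k := by
    exact_mod_cast (two_le_base hα hε₀ hε₁ n k).trans' (by norm_num)
  have h2 : 1 ≤ ⌊(base α ε n k : ℝ) ^ (1 + α)⌋₊ :=
    Nat.le_floor (by exact_mod_cast Real.one_le_rpow h1 (by linarith))
  have h3 := Nat.pow_log_le_self 2 (Nat.one_le_iff_ne_zero.mp h2)
  have h4 := Nat.floor_le (a := (base α ε n k : ℝ) ^ (1 + α)) (by positivity)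
  refine le_trans ?_ h4
  exact_mod_cast h3

/-- Up to the polylogarithmic factor `(h ^ (1 + α)) ^ 2`, there are at most `k ^ (1 + α)` right
vertices. -/
theorem rightSize_le (hα : 0 < α) (hε₀ : 0 < ε) (hε₁ : ε < 1) {n k : ℕ} (hk : 1 ≤ k) :
    (rightSize α ε n k : ℝ) ≤ (k : ℝ) ^ (1 + α) * ((base α ε n k : ℝ) ^ (1 + α)) ^ 2 := by
  have hb := two_le_base hα hε₀ hε₁ n k
  set h := base α ε n k with hh
  have hpow : h ^ numPow α ε n k ≤ k * h := by
    unfold numPow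
    rcases Nat.lt_or_ge 1 k with h1 | h1
    · have h2 := Nat.pow_pred_clog_lt_self (b := h) hb h1
      have h3 := Nat.clog_pos hb h1
      calc h ^ Nat.clog h k = h ^ (Nat.clog h k).pred * h := by
            rw [← pow_succ, ← Nat.succ_eq_add_one, Nat.succ_pred_eq_of_pos h3]
        _ ≤ k * h := Nat.mul_le_mul_right _ h2.le
    · rw [Nat.clog_of_right_le_one h1, pow_zero]
      nlinarith
  have hpow' : (h : ℝ) ^ (numPow α ε n k + 1) ≤ k * h ^ 2 := by
    have : ((h ^ numPow α ε n k : ℕ) : ℝ) ≤ ((k * h : ℕ) : ℝ) := by exact_mod_cast hpow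
    push_cast at this
    rw [pow_succ, pow_two, ← mul_assoc]
    gcongr
  calc (rightSize α ε n k : ℝ) = ((2 : ℝ) ^ fieldExp α ε n k) ^ (numPow α ε n k + 1) := by
        simp [rightSize]
    _ ≤ ((h : ℝ) ^ (1 + α)) ^ (numPow α ε n k + 1) := by
        gcongr
        exact two_pow_fieldExp_le hα hε₀ hε₁ n k
    _ = ((h : ℝ) ^ (numPow α ε n k + 1)) ^ (1 + α) := by
        rw [← Real.rpow_natCast, ← Real.rpow_mul (by positivity), mul_comm,
          Real.rpow_mul (by positivity), Real.rpow_natCast]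
    _ ≤ (k * (h : ℝ) ^ 2) ^ (1 + α) := Real.rpow_le_rpow (by positivity) hpow' (by linarith)
    _ = (k : ℝ) ^ (1 + α) * ((h : ℝ) ^ (1 + α)) ^ 2 := by
        rw [Real.mul_rpow (by positivity) (by positivity), ← Real.rpow_natCast (h : ℝ),
          ← Real.rpow_mul (by positivity), mul_comm _ (1 + α), Real.rpow_mul (by positivity),
          Real.rpow_natCast]

end GUV

/-- The size `k ≈ √(S n ^ (1 - α))` of the chunks balances the two contributions `n k ^ (1 + α) / S`
and `n ^ 2 / k` to the time. -/
theorem exists_chunk_size {α : ℝ} (hα : 0 < α) {n S : ℕ} (hS : 1 ≤ S) (hSn : S ≤ n) :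
    ∃ k : ℕ, 1 ≤ k ∧ k ≤ n ∧
      (n : ℝ) ≤ Real.sqrt ((n : ℝ) ^ (3 + α) / S) ∧
      (n : ℝ) ^ 2 / k ≤ Real.sqrt ((n : ℝ) ^ (3 + α) / S) ∧
      n * (k : ℝ) ^ (1 + α) / S ≤ 2 * Real.sqrt ((n : ℝ) ^ (3 + α) / S) := by
  have hS' : (1 : ℝ) ≤ S := by exact_mod_cast hS
  have hSn' : (S : ℝ) ≤ n := by exact_mod_cast hSn
  have hn' : (1 : ℝ) ≤ n := hS'.trans hSn'
  have hn0 : (0 : ℝ) < n := by linarith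
  have hS0 : (0 : ℝ) < S := by linarith
  set T := Real.sqrt ((n : ℝ) ^ (3 + α) / S) with hT
  set r := Real.sqrt (S * (n : ℝ) ^ (1 - α)) with hr
  have hr0 : 0 < r := Real.sqrt_pos.mpr (by positivity)
  have hr2 : r ^ 2 = S * (n : ℝ) ^ (1 - α) := Real.sq_sqrt (by positivity)
  have hrT : r * T = (n : ℝ) ^ 2 := by
    rw [hr, hT, ← Real.sqrt_mul (by positivity)]
    have : S * (n : ℝ) ^ (1 - α) * ((n : ℝ) ^ (3 + α) / S) = ((n : ℝ) ^ 2) ^ 2 := by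
      have h4 : (n : ℝ) ^ (1 - α) * (n : ℝ) ^ (3 + α) = (n : ℝ) ^ 4 := by
        rw [← Real.rpow_add hn0, ← Real.rpow_natCast]
        congr 1
        push_cast
        ring
      field_simp
      linarith
    rw [this, Real.sqrt_sq (by positivity)]
  have hnT : (n : ℝ) ≤ T := by
    refine Real.le_sqrt_of_sq_le ?_
    rw [le_div_iff₀ hS0]
    calc (n : ℝ) ^ 2 * S ≤ (n : ℝ) ^ 2 * n := by gcongr
      _ = (n : ℝ) ^ (3 : ℝ) := by
        rw [← pow_succ, ← Real.rpow_natCast]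
        norm_num
      _ ≤ (n : ℝ) ^ (3 + α) := Real.rpow_le_rpow_of_exponent_le hn' (by linarith)
  have hrn : r ≤ n := by
    refine Real.sqrt_le_iff.mpr ⟨hn0.le, ?_⟩
    have h1 : (n : ℝ) ^ (1 - α) ≤ n := by
      simpa using Real.rpow_le_rpow_of_exponent_le hn' (show 1 - α ≤ 1 by linarith)
    rw [pow_two]
    gcongr
  have hk1 : 1 ≤ ⌈r⌉₊ := Nat.ceil_pos.mpr hr0
  have hkn : ⌈r⌉₊ ≤ n := Nat.ceil_le.mpr hrn
  have hkr : r ≤ ⌈r⌉₊ := Nat.le_ceil r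
  have hk0 : (0 : ℝ) < ⌈r⌉₊ := by linarith
  refine ⟨⌈r⌉₊, hk1, hkn, hnT, ?_, ?_⟩
  · rw [div_le_iff₀ hk0, ← hrT, mul_comm]
    gcongr
  · rcases hk1.eq_or_lt with h1 | h1
    -- rounding `r` up to `1` may enlarge it by an unbounded factor, so this case is separate
    · rw [← h1, Nat.cast_one, Real.one_rpow, mul_one]
      have : (n : ℝ) / S ≤ n := div_le_self hn0.le hS'
      linarith
    · have hr1 : 1 < r := by simpa using Nat.lt_ceil.mp h1
      have hk2 : (⌈r⌉₊ : ℝ) ≤ 2 * r := by linarith [Nat.ceil_lt_add_one hr0.le]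
      have hkα : (⌈r⌉₊ : ℝ) ^ α ≤ (n : ℝ) ^ α :=
        Real.rpow_le_rpow (by positivity) (by exact_mod_cast hkn) hα.le
      have hrS : n * (r * (n : ℝ) ^ α) = T * S := by
        have h3 : (n : ℝ) ^ (1 - α) * (n : ℝ) ^ α = n := by
          rw [← Real.rpow_add hn0, sub_add_cancel, Real.rpow_one]
        refine mul_left_cancel₀ hr0.ne' ?_
        calc r * (n * (r * (n : ℝ) ^ α)) = r ^ 2 * (n : ℝ) ^ α * n := by ring
          _ = S * ((n : ℝ) ^ (1 - α) * (n : ℝ) ^ α) * n := by rw [hr2]; ring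
          _ = (r * T) * S := by rw [h3, hrT]; ring
          _ = r * (T * S) := by ring
      rw [div_le_iff₀ hS0, Real.rpow_add hk0, Real.rpow_one]
      calc n * ((⌈r⌉₊ : ℝ) * (⌈r⌉₊ : ℝ) ^ α) ≤ n * (2 * r * (n : ℝ) ^ α) := by gcongr
        _ = 2 * (n * (r * (n : ℝ) ^ α)) := by ring
        _ = 2 * T * S := by rw [hrS]; ring

theorem cast_pred_div_add_one_le {a b : ℕ} (ha : 0 < a) :
    (((a - 1) / b + 1 : ℕ) : ℝ) ≤ a / b + 1 := by
  push_cast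
  gcongr
  refine Nat.cast_div_le.trans ?_
  gcongr
  omega

/-- The total time, where `H` bounds the polylogarithmic factors of the graph and `B k` bounds the
time for one run of the matching program. -/
theorem time_estimate {α H B T : ℝ} {n k S m ℓ E : ℕ} (hn : 0 < n) (hm : 0 < m) (hk : 0 < k)
    (hkn : k ≤ n) (hH : 1 ≤ H) (hB : 1 ≤ B)
    (hmH : (m : ℝ) ≤ (k : ℝ) ^ (1 + α) * H ^ 2) (hE : (E : ℝ) ≤ n * H)
    (hℓ : (ℓ : ℝ) + k + 1 ≤ B * k) (h₁ : (n : ℝ) ≤ T) (h₂ : (n : ℝ) ^ 2 / k ≤ T)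
    (h₃ : n * (k : ℝ) ^ (1 + α) / S ≤ 2 * T) :
    ((((n - 1) / k + 1) * (((m - 1) / S + 1) * (ℓ + k + 1) + E) : ℕ) : ℝ) ≤ 8 * (B * H ^ 2) * T := by
  have hk0 : (0 : ℝ) < k := by exact_mod_cast hk
  have hn0 : (0 : ℝ) < n := by exact_mod_cast hn
  have hT : 0 < T := by linarith
  have hc : (((n - 1) / k + 1 : ℕ) : ℝ) ≤ 2 * n / k := by
    have h1 : (1 : ℝ) ≤ n / k := (one_le_div hk0).mpr (by exact_mod_cast hkn)
    have h2 := cast_pred_div_add_one_le (b := k) hn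
    rw [mul_div_assoc]
    linarith
  have hg : (((m - 1) / S + 1 : ℕ) : ℝ) ≤ (k : ℝ) ^ (1 + α) * H ^ 2 / S + 1 :=
    (cast_pred_div_add_one_le hm).trans (by gcongr)
  have hℓ' : ((ℓ + k + 1 : ℕ) : ℝ) ≤ B * k := by exact_mod_cast hℓ
  have hH2 : H ≤ H ^ 2 := by nlinarith
  have hH1 : 1 ≤ H ^ 2 := by nlinarith
  calc ((((n - 1) / k + 1) * (((m - 1) / S + 1) * (ℓ + k + 1) + E) : ℕ) : ℝ)
      = (((n - 1) / k + 1 : ℕ) : ℝ) * ((((m - 1) / S + 1 : ℕ) : ℝ) * ((ℓ + k + 1 : ℕ) : ℝ) + E) := by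
        push_cast
        ring
    _ ≤ 2 * n / k * (((k : ℝ) ^ (1 + α) * H ^ 2 / S + 1) * (B * k) + n * H) := by gcongr
    _ = 2 * (B * H ^ 2) * (n * (k : ℝ) ^ (1 + α) / S) + 2 * B * n + 2 * H * (n ^ 2 / k) := by
        field_simp
    _ ≤ 2 * (B * H ^ 2) * (2 * T) + 2 * (B * H ^ 2) * T + 2 * (B * H ^ 2) * T := by
        gcongr
        · exact le_mul_of_one_le_right (by linarith) hH1
        · exact hH2.trans (le_mul_of_one_le_left (by positivity) hB)
    _ = 8 * (B * H ^ 2) * T := by ring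

/-- The space bound: `S` copies of a vertex of the matching program and of a register for a value
in `[n]`. -/
theorem mul_pow_le_two_rpow {n S N c : ℕ} {C : ℝ} (hn : 1 ≤ n)
    (hN : (N : ℝ) ≤ (2 : ℝ) ^ (C * Real.log (n + 2) ^ c)) :
    (((N * n) ^ S : ℕ) : ℝ) ≤ (2 : ℝ) ^ ((|C| + 2) * S * Real.log (n + 2) ^ (c + 1)) := by
  set L := Real.log (n + 2) with hLdef
  have hL : 1 ≤ L := one_le_log_add_two hn
  have hLc : L ^ c ≤ L ^ (c + 1) := pow_le_pow_right₀ hL (Nat.le_succ c)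
  have hL1 : L ≤ L ^ (c + 1) := by simpa using pow_le_pow_right₀ hL (Nat.succ_le_succ c.zero_le)
  have hn2 : (n : ℝ) ≤ (2 : ℝ) ^ (2 * L) := by
    calc (n : ℝ) ≤ n + 2 := by linarith
      _ = Real.exp L := (Real.exp_log (by positivity)).symm
      _ ≤ Real.exp (Real.log 2 * (2 * L)) := by
        rw [Real.exp_le_exp]
        nlinarith [Real.log_two_gt_d9]
      _ = (2 : ℝ) ^ (2 * L) := (Real.rpow_def_of_pos (by norm_num) _).symm
  have hbase : (N : ℝ) * n ≤ (2 : ℝ) ^ ((|C| + 2) * L ^ (c + 1)) := by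
    calc (N : ℝ) * n ≤ (2 : ℝ) ^ (C * L ^ c) * (2 : ℝ) ^ (2 * L) := by gcongr
      _ = (2 : ℝ) ^ (C * L ^ c + 2 * L) := (Real.rpow_add (by norm_num) _ _).symm
      _ ≤ _ := by
        refine Real.rpow_le_rpow_of_exponent_le (by norm_num) ?_
        have h1 : C * L ^ c ≤ |C| * L ^ (c + 1) :=
          mul_le_mul (le_abs_self C) hLc (by positivity) (abs_nonneg C)
        linarith
  calc (((N * n) ^ S : ℕ) : ℝ) = ((N : ℝ) * n) ^ S := by push_cast; rfl
    _ ≤ ((2 : ℝ) ^ ((|C| + 2) * L ^ (c + 1))) ^ S := by gcongr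
    _ = _ := by
      rw [← Real.rpow_natCast, ← Real.rpow_mul (by norm_num)]
      congr 1
      ring

/-! ### The reduction -/

theorem mainTheorem2 (α ε : ℝ) (hα : 0 < α) (hε₀ : 0 < ε) (hε₁ : ε < 1)
    (G : ∀ n k : ℕ, GUV.Choice α ε n k)
    (hmatch : ∃ (C : ℝ) (c : ℕ), ∀ n k : ℕ, 1 ≤ k → k ≤ n →
      ∃ P : BranchingProgram (MatchingInput n k (GUV.rightSize α ε n k)),
        P.IsOblivious ∧
        P.HasSpace (C * Real.log (n + 2) ^ c) ∧
        P.HasTime (C * k * Real.log (n + 2) ^ c) ∧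
        P.ComputesLast (expanderMatching k (G n k).graph)) :
    ∃ (C : ℝ) (c : ℕ), ∀ n S : ℕ, 1 ≤ S → S ≤ n →
      ∃ P : BranchingProgram (fun _ : Fin n => Fin n),
        P.IsOblivious ∧
        P.HasSpace (C * S * Real.log (n + 2) ^ c) ∧
        P.HasTime (C * Real.sqrt ((n : ℝ) ^ (3 + α) / S) * Real.log (n + 2) ^ c) ∧
        P.ComputesMulti (twoStepPointerChasing n) := by
  obtain ⟨C, c, hC⟩ := hmatch
  obtain ⟨A, p, hA, hH⟩ := GUV.exists_base_rpow_le hα hε₀ hε₁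
  have hA2 : 1 ≤ A ^ 2 := one_le_pow₀ hA
  have hC0 := abs_nonneg C
  refine ⟨8 * (|C| + 2) * A ^ 2, c + 2 * p + 1, fun n S hS hSn => ?_⟩
  have hn : 1 ≤ n := hS.trans hSn
  obtain ⟨k, hk, hkn, h₁, h₂, h₃⟩ := exists_chunk_size hα hS hSn
  obtain ⟨P, hobl, hspace, htime, hP⟩ := hC n k hk hkn
  set L := Real.log (n + 2) with hLdef
  have hL : 1 ≤ L := one_le_log_add_two hn
  have hk' : (1 : ℝ) ≤ k := by exact_mod_cast hk
  have hLc : 1 ≤ L ^ c := one_le_pow₀ hL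
  have hm : 0 < GUV.rightSize α ε n k := by unfold GUV.rightSize; positivity
  obtain ⟨P', hobl', hcard, hlen, hP'⟩ := PointerChasing.exists_program
    (N := ⌊(2 : ℝ) ^ (C * L ^ c)⌋₊) hn hm hk hS
    (fun K hK => (G n k).exists_isMatchingFor hα hε₀ hε₁ K hK) P hobl
    (fun t => Nat.le_floor (hspace t)) hP
  refine ⟨P', hobl', fun t => ?_, ?_, hP'⟩
  · rw [hcard]
    refine (mul_pow_le_two_rpow hn (Nat.floor_le (by positivity))).trans ?_
    refine Real.rpow_le_rpow_of_exponent_le (by norm_num) ?_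
    gcongr ?_ * _ * ?_
    · nlinarith
    · exact pow_le_pow_right₀ hL (by omega)
  · have hb1 : (1 : ℝ) ≤ (GUV.base α ε n k : ℝ) ^ (1 + α) := by
      refine Real.one_le_rpow ?_ (by linarith)
      exact_mod_cast (GUV.two_le_base hα hε₀ hε₁ n k).trans' (by norm_num)
    have hE : ((G n k).graph.ncard : ℝ) ≤ n * (GUV.base α ε n k : ℝ) ^ (1 + α) := by
      have h : ((G n k).graph.ncard : ℝ) ≤ n * 2 ^ GUV.fieldExp α ε n k := by
        exact_mod_cast (G n k).ncard_graph_le hα hε₀ hε₁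
      refine h.trans ?_
      gcongr
      exact GUV.two_pow_fieldExp_le hα hε₀ hε₁ n k
    have hℓ : (P.length : ℝ) + k + 1 ≤ (|C| + 2) * L ^ c * k := by
      have h : (P.length : ℝ) ≤ |C| * k * L ^ c := by
        refine le_trans htime ?_
        gcongr
        exact le_abs_self C
      nlinarith
    have hB : 1 ≤ (|C| + 2) * L ^ c := by nlinarith
    have htotal := time_estimate hn hm hk hkn hb1 hB (GUV.rightSize_le hα hε₀ hε₁ hk) hE hℓ h₁ h₂ h₃
    refine (Nat.cast_le.mpr hlen).trans (htotal.trans ?_)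
    have hT := Real.sqrt_nonneg ((n : ℝ) ^ (3 + α) / S)
    calc 8 * ((|C| + 2) * L ^ c * ((GUV.base α ε n k : ℝ) ^ (1 + α)) ^ 2) *
          Real.sqrt ((n : ℝ) ^ (3 + α) / S)
        ≤ 8 * ((|C| + 2) * L ^ c * (A * L ^ p) ^ 2) * Real.sqrt ((n : ℝ) ^ (3 + α) / S) := by
          gcongr
          exact hH n k hn hkn
      _ = 8 * (|C| + 2) * A ^ 2 * Real.sqrt ((n : ℝ) ^ (3 + α) / S) * L ^ (c + 2 * p) := by ring
      _ ≤ 8 * (|C| + 2) * A ^ 2 * Real.sqrt ((n : ℝ) ^ (3 + α) / S) * L ^ (c + 2 * p + 1) := by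
          exact mul_le_mul_of_nonneg_left (pow_le_pow_right₀ hL (Nat.le_succ _)) (by positivity)
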